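/- A linearly ordered poset is a structure $(A,\sqsubseteq,<)$ in which $(A,\sqsubseteq)$ is a poset and $<$ is a linear order on $A$ extending $\sqsubseteq$ (that is, $a\sqsubseteq b$ and $a\neq b$ imply $a<b$). Embeddings are injective maps that preserve and reflect both relations; surjective embeddings are isomorphisms; $\binom{\mathcal C}{\mathcal A}$ denotes the set of substructures of $\mathcal C$ isomorphic to $\mathcal A$. A class $\mathbf K^*$ of finite linearly ordered posets has the Ramsey property if for all $\mathcal A,\mathcal B\in\mathbf K^*$ such that $\mathcal A$ embeds into $\mathcal B$ and every integer $k\ge 2$ there is a $\mathcal C\in\mathbf K^*$ such that for every colouring of $\binom{\mathcal C}{\mathcal A}$ with $k$ colours there is a $\tilde{\mathcal B}\in\binom{\mathcal C}{\mathcal B}$ for which all elements of $\binom{\tilde{\mathcal B}}{\mathcal A}$ have the same colour. Let $\mathbf K=\{(A,\sqsubseteq):(A,\sqsubseteq,<)\in\mathbf K^*\}$. The class $\mathbf K^*$ has the ordering property if for every $\mathcal A\in\mathbf K$ there is a $\mathcal B\in\mathbf K$ such that $(\mathcal A,<)$ embeds into $(\mathcal B,\prec)$ for every linear order $<$ with $(\mathcal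 A,<)\in\mathbf K^*$ and every linear order $\prec$ with $(\mathcal B,\prec)\in\mathbf K^*$. A variety of lattices (respectively, of meet semilattices) is a class of lattices $(L,\wedge,\vee)$ (respectively, meet semilattices $(L,\wedge)$), regarded as algebras, that is closed under homomorphic images, subalgebras and products of arbitrary families; it is nontrivial if it has a member with at least two elements. For such a variety $\mathbf V$ let $\overrightarrow{\mathrm{rel}}(\mathbf V^{\mathit{fin}})$ be the class of all linearly ordered posets $(L,\sqsubseteq,\prec)$ such that $L$ is the underlying set of a finite member of $\mathbf V$, $a\sqsubseteq b$ if and only if $a\wedge b=a$, and $\prec$ is any linear order on $L$ extending $\sqsubseteq$. Theorem. (a) For every nontrivial variety $\mathbf V$ of lattices, $\overrightarrow{\mathrm{rel}}(\mathbf V^{\mathit{fin}})$ has both the Ramsey property and the ordering property. (b) For every nontrivial variety $\mathbf V$ of semilattices, $\overrightarrow{\mathrm{rel}}(\mathbf V^{\mathit{fin}})$ has both the Ramsey property and the ordering property. -/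

import Mathlib

universe u

/-- A linearly ordered poset `(A, ⊑, <)`: a poset together with a (strict) linear order `lt` on the
same set that extends the partial order. -/
structure LinOrdPoset : Type (u + 1) where
  toPartOrd : PartOrd.{u}
  lt : toPartOrd → toPartOrd → Prop
  strictTotal : IsStrictTotalOrder toPartOrd lt
  extends_le : ∀ a b : toPartOrd, a ≤ b → a ≠ b → lt a b

namespace LinOrdPoset

/-- The underlying set. -/
abbrev Carrier (A : LinOrdPoset.{u}) : Type u := A.toPartOrd

/-- Embeddings of linearly ordered posets, as relational structures: injective maps which preserve
and reflect both relations. -/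
structure IsEmbedding (A B : LinOrdPoset.{u}) (f : A.Carrier → B.Carrier) : Prop where
  injective : Function.Injective f
  le_iff : ∀ a b, a ≤ b ↔ f a ≤ f b
  lt_iff : ∀ a b, A.lt a b ↔ B.lt (f a) (f b)

/-- `A` embeds into `B`. -/
def Embeds (A B : LinOrdPoset.{u}) : Prop := ∃ f, IsEmbedding A B f

/-- Isomorphism: there is a surjective embedding. -/
def Isomorphic (A B : LinOrdPoset.{u}) : Prop := ∃ f, IsEmbedding A B f ∧ Function.Surjective f

/-- The substructure of `A` on the subset `S`. The language is relational, so every subset carries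
exactly one substructure. -/
def induce (A : LinOrdPoset.{u}) (S : Set A.Carrier) : LinOrdPoset.{u} where
  toPartOrd := PartOrd.of S
  lt a b := A.lt a.1 b.1
  strictTotal :=
    { trichotomous := fun a b h₁ h₂ => Subtype.ext (A.strictTotal.trichotomous a.1 b.1 h₁ h₂)
      irrefl := fun a => A.strictTotal.irrefl a.1
      trans := fun a b c => A.strictTotal.trans a.1 b.1 c.1 }
  extends_le a b h hne := A.extends_le a.1 b.1 h (fun e => hne (Subtype.ext e))

/-- The copies of `A` in `B`: the substructures of `B` (given by their underlying sets) that are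
isomorphic to `A`. -/
def copies (A B : LinOrdPoset.{u}) : Set (Set B.Carrier) := {S | Isomorphic A (B.induce S)}

/-- The partition arrow `C ⟶ (B)^A_k`: for every colouring of the copies of `A` in `C` with `k`
colours there is a copy `T` of `B` in `C` such that all the copies of `A` in `C` that lie inside `T`
(equivalently, the copies of `A` in the substructure on `T`) have the same colour. -/
def Arrows (C B A : LinOrdPoset.{u}) (k : ℕ) : Prop :=
  ∀ χ : ↥(copies A C) → Fin k, ∃ T ∈ copies B C, ∃ j : Fin k,
    ∀ S : ↥(copies A C), S.1 ⊆ T → χ S = j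

/-- The Ramsey property of a class of (finite) linearly ordered posets. -/
def RamseyProperty (K : Set LinOrdPoset.{u}) : Prop :=
  ∀ A ∈ K, ∀ B ∈ K, Embeds A B → ∀ k : ℕ, 2 ≤ k → ∃ C ∈ K, Arrows C B A k

/-- The class of posets obtained from a class of linearly ordered posets by forgetting the linear
orders. -/
def reduct (K : Set LinOrdPoset.{u}) : Set PartOrd.{u} := {P | ∃ A ∈ K, A.toPartOrd = P}

/-- The ordering property of a class of (finite) linearly ordered posets: for every poset `P` in the
reduct there is a poset `Q` in the reduct such that `(P, <)` embeds into `(Q, ⊏)` whenever both are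
members of the class. -/
def OrderingProperty (K : Set LinOrdPoset.{u}) : Prop :=
  ∀ P ∈ reduct K, ∃ Q ∈ reduct K,
    ∀ A ∈ K, A.toPartOrd = P → ∀ B ∈ K, B.toPartOrd = Q → Embeds A B

end LinOrdPoset

/-- A variety of lattices: a class of lattices closed under homomorphic images, (isomorphic copies
of) subalgebras, and products of arbitrary families. Closure under subalgebras is only asked for
nonempty subalgebras, so that varieties are covered both under the convention that algebras may be
empty and under the convention that they may not. -/
structure LatticeVariety : Type (u + 1) where
  Mem : ∀ (L : Type u) [Lattice L], Prop
  image : ∀ (L M : Type u) [Lattice L] [Lattice M] (f : LatticeHom L M),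
    Function.Surjective f → Mem L → Mem M
  sub : ∀ (L M : Type u) [Lattice L] [Lattice M] [Nonempty M] (f : LatticeHom M L),
    Function.Injective f → Mem L → Mem M
  prod : ∀ (ι : Type u) (L : ι → Type u) [∀ i, Lattice (L i)],
    (∀ i, Mem (L i)) → Mem (∀ i, L i)

namespace LatticeVariety

/-- A variety is nontrivial if it has a member with at least two elements. -/
def IsNontrivial (V : LatticeVariety.{u}) : Prop :=
  ∃ (L : Type u) (_ : Lattice L), V.Mem L ∧ Nontrivial L

/-- The class of the posets `(L, ≤)`, where `a ≤ b ↔ a ⊓ b = a`, of finite lattices `L` in `V`. -/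
def relFin (V : LatticeVariety.{u}) : Set PartOrd.{u} :=
  {P | ∃ (L : Type u) (_ : Lattice L), Finite L ∧ V.Mem L ∧ P = PartOrd.of L}

/-- The class of all expansions of the posets of finite lattices in `V` by linear extensions. -/
def ordRelFin (V : LatticeVariety.{u}) : Set LinOrdPoset.{u} := {A | A.toPartOrd ∈ V.relFin}

end LatticeVariety

/-- A variety of (meet) semilattices: a class of semilattices closed under homomorphic images,
(isomorphic copies of) nonempty subalgebras, and products of arbitrary families. -/
structure SemilatticeVariety : Type (u + 1) where
  Mem : ∀ (L : Type u) [SemilatticeInf L], Prop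
  image : ∀ (L M : Type u) [SemilatticeInf L] [SemilatticeInf M] (f : InfHom L M),
    Function.Surjective f → Mem L → Mem M
  sub : ∀ (L M : Type u) [SemilatticeInf L] [SemilatticeInf M] [Nonempty M] (f : InfHom M L),
    Function.Injective f → Mem L → Mem M
  prod : ∀ (ι : Type u) (L : ι → Type u) [∀ i, SemilatticeInf (L i)],
    (∀ i, Mem (L i)) → Mem (∀ i, L i)

namespace SemilatticeVariety

/-- A variety is nontrivial if it has a member with at least two elements. -/
def IsNontrivial (V : SemilatticeVariety.{u}) : Prop :=
  ∃ (L : Type u) (_ : SemilatticeInf L), V.Mem L ∧ Nontrivial L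

/-- The class of the posets `(S, ≤)`, where `a ≤ b ↔ a ⊓ b = a`, of finite semilattices `S` in
`V`. -/
def relFin (V : SemilatticeVariety.{u}) : Set PartOrd.{u} :=
  {P | ∃ (L : Type u) (_ : SemilatticeInf L), Finite L ∧ V.Mem L ∧ P = PartOrd.of L}

/-- The class of all expansions of the posets of finite semilattices in `V` by linear extensions. -/
def ordRelFin (V : SemilatticeVariety.{u}) : Set LinOrdPoset.{u} := {A | A.toPartOrd ∈ V.relFin}

end SemilatticeVariety

/-!
The embeddings in these Ramsey statements are embeddings of relational structures, not of algebras.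
A nontrivial variety contains all powersets, as powers of a two-element chain, so it is enough to
know two facts about arbitrary finite linearly ordered posets `A` and `B`: some powerset with a
suitable linear extension arrows `(B)^A_k`, and some powerset contains every linear extension of a
given poset whichever way it is itself linearly extended.

The first fact comes from the Graham–Rothschild theorem on parameter words without constants
(equivalently, the finite dual Ramsey theorem). A map `a ↦ {i | a ∈ w i}` from `A` to the powerset
of `{0, …, N - 1}` is the same thing as a word `w` of length `N` over subsets of `A`; it preserves
the partial order when the letters are upper sets. Order the upper sets of `A`, and the subsets of
`{0, …, N - 1}`, lexicographically: the smaller set is the one lacking the least element of the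
symmetric difference. If every upper set occurs in `w` and the first occurrences are in
lexicographic order, then the map is an embedding of linearly ordered posets
(`IsUpperSetEnum.isEmbedding_wordMap`). Precomposing it with an embedding `e` replaces each letter
by its preimage under `e`, which is a substitution of parameter words
(`IsEmbedding.exists_isWord_preimage`). So a colouring of copies becomes a colouring of parameter
words.

The Graham–Rothschild theorem (`grahamRothschild`) is proved by induction on the number of
parameters, for all alphabets at once. A parameter word with at least one parameter is an initial
part consisting of constants, followed by a word which starts with the first parameter and may be
regarded as having one parameter fewer and one more constant. The induction hypothesis makes the
colour depend on the initial part only (`GrahamRothschild.exists_eq_of_initialPart_eq`), and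
the Hales–Jewett theorem makes it independent of the initial part (`exists_initialPart_mono`).

For the second fact, fix a powerset `B` containing all linear extensions of the given poset, and a
powerset `C` which arrows `B` for pairs of incomparable elements. Given another linear extension of
`C`, colour each such pair according to whether the two orders agree on it. On a monochromatic copy
of `B` they agree throughout, since reversing all incomparable pairs of `B` would create a cycle.
-/

/-! ### Parameter words and substitution -/

namespace ParameterWord

/-- `IsWord a m l`: the list `l` is a parameter word with `m` parameters over an alphabet of `a`
constants. The constants are `0, …, a - 1` and the parameters `a, …, a + m - 1`; every parameter
occurs, and their first occurrences are in increasing order. Once a parameter has occurred it is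
treated like a constant, whence the recursion. -/
inductive IsWord : ℕ → ℕ → List ℕ → Prop
  | nil (a : ℕ) : IsWord a 0 []
  | old {a m c : ℕ} {l : List ℕ} (hc : c < a) (h : IsWord a m l) : IsWord a m (c :: l)
  | new {a m : ℕ} {l : List ℕ} (h : IsWord (a + 1) m l) : IsWord a (m + 1) (a :: l)

/-- Substitution of the letters of `g` for the parameters `a, a + 1, …`, leaving the constants below
`a` fixed. The composition of parameter words `f` and `g` is `f.map (sub a g)`. Parameters beyond
the length of `g` are sent to the junk letter `0`. -/
def sub (a : ℕ) (g : List ℕ) (c : ℕ) : ℕ := if c < a then c else g.getD (c - a) 0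

/-- Renames the parameters `a, a + 1, …` to `a + 1, a + 2, …`, making room for a new constant `a`. -/
def shift (a : ℕ) (c : ℕ) : ℕ := if c < a then c else c + 1

/-- The part of a word before its first parameter. -/
def initialPart (a : ℕ) (l : List ℕ) : List ℕ := l.takeWhile (fun c => decide (c < a))

theorem sub_of_lt {a c : ℕ} (g : List ℕ) (h : c < a) : sub a g c = c := by simp [sub, h]

theorem map_sub_of_forall_lt {a : ℕ} {v : List ℕ} (g : List ℕ) (hv : ∀ c ∈ v, c < a) :
    v.map (sub a g) = v :=
  (List.map_congr_left fun c hc => sub_of_lt g (hv c hc)).trans (List.map_id _)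

theorem sub_add (a i : ℕ) (g : List ℕ) : sub a g (a + i) = g.getD i 0 := by simp [sub]

theorem sub_cons_self (a x : ℕ) (g : List ℕ) : sub a (x :: g) a = x := by simp [sub]

theorem sub_cons_add (a x i : ℕ) (g : List ℕ) : sub a (x :: g) (a + 1 + i) = g.getD i 0 := by
  rw [show a + 1 + i = a + (i + 1) by omega, sub_add]; simp

theorem sub_cons_shift (a x : ℕ) (g : List ℕ) (c : ℕ) : sub a (x :: g) (shift a c) = sub a g c := by
  unfold shift
  split_ifs with h
  · rw [sub_of_lt _ h, sub_of_lt _ h]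
  · obtain ⟨i, rfl⟩ := Nat.exists_eq_add_of_le (not_lt.1 h)
    rw [show a + i + 1 = a + 1 + i by omega, sub_cons_add, sub_add]

theorem map_shift_map_sub_cons (a x : ℕ) (f g : List ℕ) :
    (f.map (shift a)).map (sub a (x :: g)) = f.map (sub a g) := by
  rw [List.map_map]
  exact List.map_congr_left fun c _ => sub_cons_shift a x g c

theorem map_shift_map_sub (a : ℕ) (f g : List ℕ) :
    (f.map (shift a)).map (sub (a + 1) g) = f.map (sub a g) := by
  rw [List.map_map]
  refine List.map_congr_left fun c _ => ?_
  simp only [Function.comp, shift, sub]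
  split_ifs <;> first | omega | simp [Nat.add_sub_add_right]

theorem map_sub_cons_self (a : ℕ) (f g : List ℕ) :
    f.map (sub a (a :: g)) = f.map (sub (a + 1) g) := by
  refine List.map_congr_left fun c _ => ?_
  rcases lt_trichotomy c a with h | rfl | h
  · rw [sub_of_lt _ h, sub_of_lt _ (by omega)]
  · rw [sub_cons_self, sub_of_lt _ (by omega)]
  · obtain ⟨i, rfl⟩ := Nat.exists_eq_add_of_le (Nat.succ_le_of_lt h)
    rw [Nat.succ_eq_add_one, sub_cons_add, sub_add]

namespace IsWord

theorem lt {a m : ℕ} {l : List ℕ} (h : IsWord a m l) : ∀ c ∈ l, c < a + m := by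
  induction h with
  | nil => simp
  | old hc _ ih =>
    intro c hm
    rcases List.mem_cons.1 hm with rfl | hm
    · omega
    · exact ih c hm
  | new _ ih =>
    intro c hm
    rcases List.mem_cons.1 hm with rfl | hm
    · omega
    · have := ih c hm; omega

theorem mem {a m : ℕ} {l : List ℕ} (h : IsWord a m l) : ∀ c, a ≤ c → c < a + m → c ∈ l := by
  induction h with
  | nil => intros; omega
  | old hc _ ih => intro c h1 h2; exact List.mem_cons_of_mem _ (ih c h1 h2)
  | @new a m l _ ih =>
    intro c h1 h2
    rcases h1.eq_or_lt with rfl | h1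
    · simp
    · exact List.mem_cons_of_mem _ (ih c h1 (by omega))

theorem exists_lt_getElem {a m : ℕ} {l : List ℕ} (h : IsWord a m l) :
    ∀ i (hi : i < l.length), ∀ c, a ≤ c → c < l[i] → ∃ j, ∃ hj : j < i, l[j] = c := by
  induction h with
  | nil => intro i hi; simp at hi
  | old hc _ ih =>
    intro i hi c h1 h2
    cases i with
    | zero => simp at h2; omega
    | succ i =>
      obtain ⟨j, hj, e⟩ := ih i (by simpa using hi) c h1 (by simpa using h2)
      exact ⟨j + 1, by omega, by simpa using e⟩
  | @new a m l _ ih =>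
    intro i hi c h1 h2
    cases i with
    | zero => simp at h2; omega
    | succ i =>
      rcases h1.eq_or_lt with rfl | h1
      · exact ⟨0, by omega, by simp⟩
      obtain ⟨j, hj, e⟩ := ih i (by simpa using hi) c h1 (by simpa using h2)
      exact ⟨j + 1, by omega, by simpa using e⟩

theorem of_getElem {a m : ℕ} {l : List ℕ} (hlt : ∀ c ∈ l, c < a + m)
    (hmem : ∀ c, a ≤ c → c < a + m → c ∈ l)
    (hfirst : ∀ i (hi : i < l.length), ∀ c, a ≤ c → c < l[i] → ∃ j, ∃ hj : j < i, l[j] = c) :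
    IsWord a m l := by
  induction l generalizing a m with
  | nil =>
    cases m with
    | zero => exact nil a
    | succ m => simpa using hmem a le_rfl (by omega)
  | cons x l ih =>
    rcases lt_or_ge x a with hx | hx
    · refine old hx (ih (fun c hc => hlt c (List.mem_cons_of_mem _ hc)) ?_ ?_)
      · intro c h1 h2
        rcases List.mem_cons.1 (hmem c h1 h2) with rfl | h
        · omega
        · exact h
      · intro i hi c h1 h2
        obtain ⟨j, hj, e⟩ := hfirst (i + 1) (by simpa using hi) c h1 (by simpa using h2)
        cases j with
        | zero => simp at e; omega
        | succ j => exact ⟨j, by omega, by simpa using e⟩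
    · have hxa : x = a := by
        by_contra hne
        obtain ⟨j, hj, _⟩ := hfirst 0 (by simp) a le_rfl (by simp; omega)
        omega
      subst hxa
      obtain ⟨m, rfl⟩ : ∃ k, m = k + 1 :=
        ⟨m - 1, by have := hlt x (by simp); omega⟩
      refine new (ih (fun c hc => by have := hlt c (List.mem_cons_of_mem _ hc); omega) ?_ ?_)
      · intro c h1 h2
        rcases List.mem_cons.1 (hmem c (by omega) (by omega)) with rfl | h
        · omega
        · exact h
      · intro i hi c h1 h2
        obtain ⟨j, hj, e⟩ := hfirst (i + 1) (by simpa using hi) c (by omega) (by simpa using h2)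
        cases j with
        | zero => simp at e; omega
        | succ j => exact ⟨j, by omega, by simpa using e⟩

/-- Substituting a word `g` over another alphabet into a word gives a word; `σ` is any renaming
which agrees with `g` on the parameters and sends constants to constants. -/
theorem map {a n b m : ℕ} {f g : List ℕ} (hf : IsWord a n f) (hg : IsWord b m g)
    (hlen : g.length = n) (σ : ℕ → ℕ) (hσ : ∀ c < a, σ c < b)
    (hσ' : ∀ i, i < n → σ (a + i) = g.getD i 0) : IsWord b m (f.map σ) := by
  induction hf generalizing b m g with
  | nil =>
    obtain rfl := List.length_eq_zero_iff.1 hlen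
    simpa using hg
  | old hc _ ih => exact old (hσ _ hc) (ih hg hlen hσ hσ')
  | @new a n l _ ih =>
    have h0 := hσ' 0 (by omega)
    cases hg with
    | nil => simp at hlen
    | @old _ _ x g hx hg =>
      simp only [add_zero, List.getD_cons_zero] at h0
      rw [List.map_cons, h0]
      refine old hx (ih hg (by simpa using hlen) (fun c hc => ?_) (fun i hi => ?_))
      · rcases Nat.lt_succ_iff_lt_or_eq.1 hc with hc | rfl
        · exact hσ c hc
        · omega
      · rw [show a + 1 + i = a + (i + 1) by omega, hσ' _ (by omega)]; simp
    | @new _ m g hg =>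
      simp only [add_zero, List.getD_cons_zero] at h0
      rw [List.map_cons, h0]
      refine new (ih hg (by simpa using hlen) (fun c hc => ?_) (fun i hi => ?_))
      · rcases Nat.lt_succ_iff_lt_or_eq.1 hc with hc | rfl
        · have := hσ c hc; omega
        · omega
      · rw [show a + 1 + i = a + (i + 1) by omega, hσ' _ (by omega)]; simp

theorem comp {a b n m : ℕ} {f g : List ℕ} (hf : IsWord a n f) (hg : IsWord b m g)
    (hlen : g.length = n) (hab : a ≤ b) : IsWord b m (f.map (sub a g)) :=
  hf.map hg hlen _ (fun c hc => by rw [sub_of_lt _ hc]; omega) (fun i _ => sub_add a i g)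

theorem identity (a n : ℕ) : IsWord a n (List.range' a n) := by
  induction n generalizing a with
  | zero => exact nil a
  | succ n ih => rw [List.range'_succ]; exact new (ih (a + 1))

theorem map_shift {a n : ℕ} {f : List ℕ} (hf : IsWord a n f) :
    IsWord (a + 1) n (f.map (shift a)) := by
  refine hf.map (identity (a + 1) n) (by simp) _ (fun c hc => ?_) (fun i hi => ?_)
  · simp only [shift, hc, if_true]; omega
  · rw [List.getD_eq_getElem _ _ (by simpa using hi), List.getElem_range']
    simp only [shift]; split_ifs <;> omega

theorem append {a m : ℕ} {v l : List ℕ} (hv : ∀ c ∈ v, c < a) (h : IsWord a m l) :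
    IsWord a m (v ++ l) := by
  induction v with
  | nil => exact h
  | cons x v ih =>
    exact old (hv x (by simp)) (ih fun c hc => hv c (List.mem_cons_of_mem _ hc))

theorem map_sub_map_sub {a n : ℕ} {f : List ℕ} (hf : IsWord a n f) (g k : List ℕ)
    (hg : g.length = n) : (f.map (sub a g)).map (sub a k) = f.map (sub a (g.map (sub a k))) := by
  rw [List.map_map]
  refine List.map_congr_left fun c hc => ?_
  have hlt := hf.lt c hc
  rcases lt_or_ge c a with h | h
  · simp [sub_of_lt _ h]
  · obtain ⟨i, rfl⟩ := Nat.exists_eq_add_of_le h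
    simp only [Function.comp, sub_add]
    rw [List.getD_eq_getElem _ _ (by omega), List.getD_eq_getElem _ _ (by simp; omega),
      List.getElem_map]

theorem exists_mem_ge {a m : ℕ} {l : List ℕ} (h : IsWord a (m + 1) l) : ∃ c ∈ l, a ≤ c :=
  ⟨a, h.mem a le_rfl (by omega), le_rfl⟩

end IsWord

theorem initialPart_cons_of_lt {a x : ℕ} (l : List ℕ) (h : x < a) :
    initialPart a (x :: l) = x :: initialPart a l := by simp [initialPart, h]

theorem initialPart_cons_of_ge {a x : ℕ} (l : List ℕ) (h : a ≤ x) :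
    initialPart a (x :: l) = [] := by simp [initialPart, h]

theorem initialPart_append {a : ℕ} {v : List ℕ} (hv : ∀ c ∈ v, c < a) (l : List ℕ) :
    initialPart a (v ++ l) = v ++ initialPart a l :=
  List.takeWhile_append_of_pos (by simpa using hv)

theorem initialPart_eq_self {a : ℕ} {v : List ℕ} (hv : ∀ c ∈ v, c < a) :
    initialPart a v = v := List.takeWhile_eq_self_iff.2 (by simpa using hv)

theorem length_initialPart_le (a : ℕ) (l : List ℕ) : (initialPart a l).length ≤ l.length :=
  (List.takeWhile_sublist _).length_le

/-! ### Hales–Jewett and initial parts -/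

/-- The Hales–Jewett theorem, with the line written as a word `u₀ ++ a :: u₁` whose only parameter is
`a`. -/
theorem exists_line (a : ℕ) (κ : Type) [Finite κ] : ∃ L : ℕ, ∀ C : (Fin L → Fin a) → κ,
    ∃ u₀ u₁ : List ℕ, (∀ c ∈ u₀, c < a) ∧ (∀ c ∈ u₁, c ≤ a) ∧ (u₀ ++ a :: u₁).length = L ∧
      ∃ F : Fin a → Fin L → Fin a, (∀ x y, C (F x) = C (F y)) ∧
        ∀ x : Fin a, ∀ g : List ℕ,
          (u₀ ++ a :: u₁).map (sub a (x :: g)) = List.ofFn (fun i => (F x i : ℕ)) := by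
  obtain ⟨L, hL⟩ := Combinatorics.Subspace.exists_mono_in_high_dimension_fin (Fin a) κ Unit
  refine ⟨L, fun C => ?_⟩
  obtain ⟨l, k, hk⟩ := hL C
  let u : List ℕ := List.ofFn fun i => Sum.elim (fun c : Fin a => (c : ℕ)) (fun _ => a) (l.idxFun i)
  have hu : ∀ c ∈ u, c ≤ a := by
    intro c hc
    obtain ⟨i, rfl⟩ := (List.mem_ofFn' _ _).1 hc
    beta_reduce
    rcases l.idxFun i with c | c
    · exact c.2.le
    · exact le_rfl
  have hau : a ∈ u := by
    obtain ⟨i, hi⟩ := l.proper ()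
    exact (List.mem_ofFn' _ _).2 ⟨i, by simp [hi]⟩
  obtain ⟨u₀, u₁, he, h0⟩ := List.eq_append_cons_of_mem hau
  refine ⟨u₀, u₁, fun c hc => ?_, fun c hc => hu c (by rw [he]; simp [hc]), ?_,
    fun x => l (fun _ => x), fun x y => (hk _).trans (hk _).symm, fun x g => ?_⟩
  · exact lt_of_le_of_ne (hu c (by rw [he]; simp [hc])) (fun e => h0 (e ▸ hc))
  · rw [← he]; simp [u]
  · rw [← he, List.map_ofFn]
    congr 1
    funext i
    simp only [Function.comp, Combinatorics.Subspace.apply_def]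
    rcases l.idxFun i with c | c
    · simp [sub_of_lt _ c.2]
    · simp [sub_cons_self]

/-- By concatenating Hales–Jewett lines one finds a word `f` such that the colour of the initial part
of a composition of `f` with `g` depends only on the length of the initial part of `g`. -/
theorem exists_forall_initialPart_eq (a n : ℕ) : ∀ (κ : Type) [Finite κ],
    ∃ N : ℕ, ∀ χ : List ℕ → κ, ∃ f, IsWord a n f ∧ f.length = N ∧ ∃ c : ℕ → κ,
      ∀ g : List ℕ, g.length = n →
        χ (initialPart a (f.map (sub a g))) = c (initialPart a g).length := by
  induction n with
  | zero =>
    intro κ _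
    refine ⟨0, fun χ => ⟨[], .nil a, rfl, fun _ => χ [], fun g _ => rfl⟩⟩
  | succ n ih =>
    intro κ _
    -- The colour is to be constant on the line for each of the `n + 1` lengths of initial parts that
    -- may follow it.
    obtain ⟨L, hL⟩ := exists_line a (Fin (n + 1) → κ)
    obtain ⟨N, hN⟩ := ih ((Fin L → Fin a) → κ)
    refine ⟨L + N, fun χ => ?_⟩
    obtain ⟨f, hf, hfl, c, hc⟩ :=
      hN fun y v => χ (List.ofFn (fun i => (v i : ℕ)) ++ y)
    obtain ⟨u₀, u₁, h0, h1, hl, F, hF, hFe⟩ := hL fun v q => c q v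
    refine ⟨u₀ ++ a :: u₁ ++ f.map (shift a), ?_, ?_, fun q => ?_, ?_⟩
    · rw [List.append_assoc]
      exact .append h0 (.new (.append (fun c hc => Nat.lt_succ_of_le (h1 c hc)) hf.map_shift))
    · rw [List.length_append, hl, List.length_map, hfl]
    -- If there are no constant letters, then every initial part is empty.
    · exact if h : 0 < a ∧ 0 < q then c (q - 1) (F ⟨0, h.1⟩) else χ u₀
    · intro g hg
      obtain ⟨x, g, rfl⟩ := List.exists_cons_of_length_eq_add_one hg
      have hg : g.length = n := by simpa using hg
      rcases lt_or_ge x a with hx | hx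
      · have ha : 0 < a := by omega
        beta_reduce
        rw [initialPart_cons_of_lt _ hx, dif_pos (show _ ∧ _ from ⟨ha, by simp⟩), List.map_append,
          map_shift_map_sub_cons, hFe ⟨x, hx⟩ g, initialPart_append]
        · have := congrFun (hc g hg) (F ⟨x, hx⟩)
          refine this.trans ?_
          have h2 := congrFun (hF ⟨x, hx⟩ ⟨0, ha⟩) ⟨(initialPart a g).length,
            Nat.lt_succ_of_le ((length_initialPart_le a g).trans hg.le)⟩
          simpa using h2
        · intro c hc
          obtain ⟨i, rfl⟩ := (List.mem_ofFn' _ _).1 hc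
          exact (F _ i).2
      · beta_reduce
        rw [initialPart_cons_of_ge _ hx, dif_neg (by simp), List.append_assoc, List.map_append,
          map_sub_of_forall_lt _ h0,
          initialPart_append h0, List.cons_append, List.map_cons, sub_cons_self,
          initialPart_cons_of_ge _ hx, List.append_nil]

/-- Given a set `T` with at least `n` elements below `n'`, some word of length `n'` has the first
occurrences of its `n` parameters at positions in `T`, all other positions being filled with the
constant `0`. -/
theorem exists_length_initialPart_mem {a : ℕ} (ha : 0 < a) (n' : ℕ) : ∀ (n : ℕ) (T : Set ℕ),
    n ≤ (T ∩ Set.Iio n').ncard → ∃ h, IsWord a n h ∧ h.length = n' ∧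
      ∀ g : List ℕ, g.length = n → (∃ c ∈ g, a ≤ c) →
        (initialPart a (h.map (sub a g))).length ∈ T := by
  induction n' with
  | zero =>
    intro n T hn
    obtain rfl : n = 0 := by simpa using hn
    refine ⟨[], .nil a, rfl, fun g hg => ?_⟩
    obtain rfl := List.length_eq_zero_iff.1 hg
    simp
  | succ n' ih =>
    intro n T hn
    have hsub : T ∩ Set.Iio (n' + 1) ⊆
        (T ∩ {0}) ∪ Nat.succ '' ((Nat.succ ⁻¹' T) ∩ Set.Iio n') := by
      rintro (_ | q) ⟨h1, h2⟩
      · exact Or.inl ⟨h1, rfl⟩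
      · exact Or.inr ⟨q, ⟨h1, Nat.lt_of_succ_lt_succ h2⟩, rfl⟩
    have hcard := (Set.ncard_le_ncard hsub (((Set.finite_singleton 0).inter_of_right T).union
      (((Set.finite_Iio n').inter_of_right _).image _))).trans (Set.ncard_union_le _ _)
    rw [Set.ncard_image_of_injective _ Nat.succ_injective] at hcard
    by_cases h0 : 0 ∈ T ∧ n ≠ 0
    · obtain ⟨n, rfl⟩ := Nat.exists_eq_succ_of_ne_zero h0.2
      have h1 : (T ∩ {0}).ncard ≤ 1 :=
        (Set.ncard_le_ncard Set.inter_subset_right (Set.finite_singleton 0)).trans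
          (Set.ncard_singleton 0).le
      obtain ⟨h, hh, hl, hT⟩ := ih n (Nat.succ ⁻¹' T) (by omega)
      refine ⟨a :: h.map (shift a), .new hh.map_shift, by simp [hl], fun g hg hga => ?_⟩
      obtain ⟨x, g, rfl⟩ := List.exists_cons_of_length_eq_add_one hg
      rw [List.map_cons, sub_cons_self, map_shift_map_sub_cons]
      rcases lt_or_ge x a with hx | hx
      · rw [initialPart_cons_of_lt _ hx]
        refine hT g (by simpa using hg) ?_
        obtain ⟨c, hc, hca⟩ := hga
        rcases List.mem_cons.1 hc with rfl | hc
        · omega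
        · exact ⟨c, hc, hca⟩
      · rw [initialPart_cons_of_ge _ hx]; exact h0.1
    · have hn' : n ≤ ((Nat.succ ⁻¹' T) ∩ Set.Iio n').ncard := by
        by_cases hn0 : n = 0
        · omega
        · have : T ∩ {0} = ∅ := by
            ext q
            simp only [Set.mem_inter_iff, Set.mem_singleton_iff, Set.mem_empty_iff_false, iff_false]
            rintro ⟨hq, rfl⟩
            exact h0 ⟨hq, hn0⟩
          rw [this, Set.ncard_empty] at hcard
          omega
      obtain ⟨h, hh, hl, hT⟩ := ih n (Nat.succ ⁻¹' T) hn'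
      refine ⟨0 :: h, .old ha hh, by simp [hl], fun g hg hga => ?_⟩
      rw [List.map_cons, sub_of_lt _ ha, initialPart_cons_of_lt _ ha]
      exact hT g hg hga

/-- By the pigeonhole principle many lengths get the same colour in `exists_forall_initialPart_eq`;
restricting to them makes the colour of initial parts constant. -/
theorem exists_initialPart_mono {a : ℕ} (ha : 0 < a) (n : ℕ) (κ : Type) [Finite κ] :
    ∃ N : ℕ, ∀ χ : List ℕ → κ, ∃ f, IsWord a n f ∧ f.length = N ∧ ∃ k : κ,
      ∀ g : List ℕ, g.length = n → (∃ c ∈ g, a ≤ c) →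
        χ (initialPart a (f.map (sub a g))) = k := by
  cases nonempty_fintype κ
  obtain ⟨N, hN⟩ := exists_forall_initialPart_eq a (Fintype.card κ * n) κ
  refine ⟨N, fun χ => ?_⟩
  obtain ⟨f, hf, hfl, c, hc⟩ := hN χ
  have : Nonempty κ := ⟨χ []⟩
  obtain ⟨k, hk⟩ : ∃ k, n ≤ (c ⁻¹' {k} ∩ Set.Iio (Fintype.card κ * n)).ncard := by
    classical
    obtain ⟨k, -, hk⟩ := Finset.exists_le_card_fiber_of_mul_le_card_of_maps_to
      (s := Finset.range (Fintype.card κ * n)) (t := Finset.univ) (f := c) (n := n)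
      (fun _ _ => Finset.mem_univ _) Finset.univ_nonempty (by simp)
    refine ⟨k, hk.trans (le_of_eq ?_)⟩
    rw [← Set.ncard_coe_finset]
    congr 1
    ext q
    simp [and_comm]
  obtain ⟨h, hh, hl, hT⟩ := exists_length_initialPart_mem ha _ n _ hk
  refine ⟨f.map (sub a h), hf.comp hh hl le_rfl, by simp [hfl], k, fun g hg hga => ?_⟩
  rw [hf.map_sub_map_sub h g hl, hc _ (by simp [hl])]
  exact hT g hg hga

/-! ### The Graham–Rothschild theorem -/

/-- The Graham–Rothschild theorem for words with `m` parameters over `a` constants: for every `n`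
and every finite set of colours there is `N` such that for every colouring of words of length `N`
some word `f` of length `N` with `n` parameters has all its compositions with words in `m`
parameters of the same colour. -/
def GrahamRothschild (a m : ℕ) : Prop :=
  ∀ (n : ℕ) (κ : Type) [Finite κ], ∃ N : ℕ, ∀ χ : List ℕ → κ, ∃ f, IsWord a n f ∧ f.length = N ∧
    ∃ k : κ, ∀ g, IsWord a m g → g.length = n → χ (f.map (sub a g)) = k

/-- The induction is on the length `n`. The first letter of `f` is its first parameter. If it is
replaced by the first parameter `a`, then what follows is a word with `m` parameters over `a + 1`
constants, to which `H` applies; if it is replaced by a constant, then the induction hypothesis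
applies, for all constants `x < a` at once. -/
theorem GrahamRothschild.exists_eq_of_initialPart_eq {a m : ℕ} (H : GrahamRothschild (a + 1) m)
    (n : ℕ) : ∀ (κ : Type) [Finite κ], ∃ N : ℕ, ∀ χ : List ℕ → κ, ∃ f, IsWord a n f ∧
      f.length = N ∧ ∀ g₁ g₂, IsWord a (m + 1) g₁ → IsWord a (m + 1) g₂ → g₁.length = n →
        g₂.length = n → initialPart a g₁ = initialPart a g₂ →
          χ (f.map (sub a g₁)) = χ (f.map (sub a g₂)) := by
  induction n with
  | zero =>
    intro κ _
    refine ⟨0, fun χ => ⟨[], .nil a, rfl, fun _ _ _ _ _ _ _ => rfl⟩⟩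
  | succ n ih =>
    intro κ _
    obtain ⟨N₁, hN₁⟩ := ih (Fin a → κ)
    obtain ⟨N, hN⟩ := H N₁ κ
    refine ⟨N + 1, fun χ => ?_⟩
    obtain ⟨h, hh, hhl, k, hk⟩ := hN fun l => χ (a :: l)
    obtain ⟨f, hf, hfl, hF⟩ := hN₁ fun y x => χ (x :: h.map (sub a (x :: y)))
    have key : ∀ (x : ℕ) (g : List ℕ),
        (a :: h.map (sub (a + 1) (f.map (shift a)))).map (sub a (x :: g)) =
          x :: h.map (sub a (x :: f.map (sub a g))) := by
      intro x g
      rw [List.map_cons, sub_cons_self, List.map_map]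
      congr 1
      refine List.map_congr_left fun c hc => ?_
      have hlt := hh.lt c hc
      simp only [Function.comp]
      rcases lt_trichotomy c a with h' | rfl | h'
      · rw [sub_of_lt _ (show c < a + 1 by omega), sub_of_lt _ h', sub_of_lt _ h']
      · rw [sub_of_lt _ (show c < c + 1 by omega), sub_cons_self, sub_cons_self]
      · obtain ⟨i, rfl⟩ := Nat.exists_eq_add_of_le (Nat.succ_le_of_lt h')
        rw [Nat.succ_eq_add_one] at hlt ⊢
        rw [sub_add, sub_cons_add, List.getD_eq_getElem _ _ (by simp; omega),
          List.getD_eq_getElem _ _ (by simp; omega), List.getElem_map, List.getElem_map,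
          sub_cons_shift]
    have hconst : ∀ g, IsWord (a + 1) m g → g.length = n →
        χ (a :: h.map (sub a (a :: f.map (sub a g)))) = k := by
      intro g hg hgl
      rw [map_sub_cons_self, ← map_shift_map_sub a f g]
      exact hk _ (hf.map_shift.comp hg hgl le_rfl) (by simp [hfl])
    refine ⟨a :: h.map (sub (a + 1) (f.map (shift a))), ?_, by simp [hhl], ?_⟩
    · exact .new (hh.comp hf.map_shift (by simp [hfl]) le_rfl)
    · intro g₁ g₂ hg₁ hg₂ hl₁ hl₂ he
      cases hg₁ with
      | @old _ _ x g₁ hx hg₁ =>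
        rw [initialPart_cons_of_lt _ hx] at he
        cases hg₂ with
        | @old _ _ y g₂ hy hg₂ =>
          rw [initialPart_cons_of_lt _ hy] at he
          obtain ⟨rfl, he'⟩ := List.cons_eq_cons.1 he
          rw [key, key]
          exact congrFun (hF g₁ g₂ hg₁ hg₂ (by simpa using hl₁) (by simpa using hl₂) he') ⟨x, hx⟩
        | new _ => rw [initialPart_cons_of_ge _ le_rfl] at he; cases he
      | @new _ _ g₁ hg₁ =>
        rw [initialPart_cons_of_ge _ le_rfl] at he
        cases hg₂ with
        | old hy _ => rw [initialPart_cons_of_lt _ hy] at he; cases he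
        | @new _ _ g₂ hg₂ =>
          rw [key, key, hconst g₁ hg₁ (by simpa using hl₁), hconst g₂ hg₂ (by simpa using hl₂)]

theorem grahamRothschild_zero (a : ℕ) : GrahamRothschild a 0 := by
  intro n κ _
  obtain ⟨N, hN⟩ := exists_forall_initialPart_eq a n κ
  refine ⟨N, fun χ => ?_⟩
  obtain ⟨f, hf, hfl, c, hc⟩ := hN χ
  refine ⟨f, hf, hfl, c n, fun g hg hgl => ?_⟩
  have h := hc g hgl
  rwa [initialPart_eq_self (a := a) (hf.comp hg hgl le_rfl).lt, initialPart_eq_self (a := a) hg.lt,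
    hgl] at h

theorem grahamRothschild (a m : ℕ) : GrahamRothschild a m := by
  induction m generalizing a with
  | zero => exact grahamRothschild_zero a
  | succ m ih =>
    intro n κ _
    rcases Nat.eq_zero_or_pos a with rfl | ha
    -- Without constants every initial part is empty.
    · obtain ⟨N, hN⟩ := (ih 1).exists_eq_of_initialPart_eq n κ
      refine ⟨N, fun χ => ?_⟩
      obtain ⟨f, hf, hfl, hF⟩ := hN χ
      by_cases hex : ∃ g₀, IsWord 0 (m + 1) g₀ ∧ g₀.length = n
      · obtain ⟨g₀, hg₀, hl₀⟩ := hex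
        refine ⟨f, hf, hfl, χ (f.map (sub 0 g₀)), fun g hg hgl => hF g g₀ hg hg₀ hgl hl₀ ?_⟩
        have : ∀ l, initialPart 0 l = [] := by
          rintro (_ | ⟨x, l⟩)
          · rfl
          · exact initialPart_cons_of_ge _ (Nat.zero_le x)
        rw [this, this]
      · exact ⟨f, hf, hfl, χ [], fun g hg hgl => (hex ⟨g, hg, hgl⟩).elim⟩
    · obtain ⟨n', hn'⟩ := exists_initialPart_mono ha n κ
      obtain ⟨N, hN⟩ := (ih (a + 1)).exists_eq_of_initialPart_eq n' κ
      refine ⟨N, fun χ => ?_⟩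
      obtain ⟨f, hf, hfl, hF⟩ := hN χ
      classical
      -- The colour of an initial part is the colour common to all words that start with it.
      obtain ⟨h, hh, hhl, k, hk⟩ := hn' fun p =>
        if hex : ∃ g, IsWord a (m + 1) g ∧ g.length = n' ∧ initialPart a g = p then
          χ (f.map (sub a hex.choose)) else χ []
      refine ⟨f.map (sub a h), hf.comp hh hhl le_rfl, by simp [hfl], k, fun g hg hgl => ?_⟩
      rw [hf.map_sub_map_sub h g hhl, ← hk g hgl hg.exists_mem_ge]
      have hw := hh.comp hg hgl le_rfl
      have hex : ∃ g', IsWord a (m + 1) g' ∧ g'.length = n' ∧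
          initialPart a g' = initialPart a (h.map (sub a g)) := ⟨_, hw, by simp [hhl], rfl⟩
      rw [dif_pos hex]
      obtain ⟨h1, h2, h3⟩ := hex.choose_spec
      exact hF _ _ hw h1 (by simp [hhl]) h2 h3.symm

end ParameterWord

namespace LinOrdPoset

open ParameterWord

/-! ### Lexicographic orders on sets of subsets -/

/-- The lexicographic order on the subsets of `X` induced by a relation `r` on `X`: for a finite
strict linear order `r`, `S` comes before `T` if the `r`-least element of the symmetric difference
lies in `T`. -/
def LexLT {X : Type*} (r : X → X → Prop) (S T : Set X) : Prop :=
  ∃ i, i ∈ T ∧ i ∉ S ∧ ∀ j, r j i → (j ∈ S ↔ j ∈ T)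

section LexLT

variable {X : Type*} {r : X → X → Prop} [IsStrictTotalOrder X r] [Finite X]

/-- To see `S` before `T` it is enough to have an element `i` of `T \ S` below which `S ⊆ T`: the
least element of `T \ S` is then the least element of the symmetric difference. -/
theorem lexLT_of_forall {S T : Set X} {i : X} (hT : i ∈ T) (hS : i ∉ S)
    (h : ∀ j, r j i → j ∈ S → j ∈ T) : LexLT r S T := by
  obtain ⟨m, ⟨hmT, hmS⟩, hmin⟩ :=
    (Finite.wellFounded_of_trans_of_irrefl r).has_min {j | j ∈ T ∧ j ∉ S} ⟨i, hT, hS⟩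
  refine ⟨m, hmT, hmS, fun j hj => ⟨fun hjS => h j ?_ hjS, fun hjT => ?_⟩⟩
  · rcases trichotomous_of r m i with hmi | rfl | hmi
    · exact _root_.trans hj hmi
    · exact hj
    · exact (hmin i ⟨hT, hS⟩ hmi).elim
  · by_contra hjS
    exact hmin j ⟨hjT, hjS⟩ hj

theorem lexLT_of_subset {S T : Set X} (h : S ⊆ T) (hne : S ≠ T) : LexLT r S T := by
  obtain ⟨i, hT, hS⟩ := Set.exists_of_ssubset (h.ssubset_of_ne hne)
  exact lexLT_of_forall hT hS fun j _ hj => h hj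

theorem isStrictTotalOrder_lexLT : IsStrictTotalOrder (Set X) (LexLT r) where
  irrefl := fun _ ⟨_, h1, h2, _⟩ => h2 h1
  trans := by
    rintro S T R ⟨i, hiT, hiS, hi⟩ ⟨k, hkR, hkT, hk⟩
    rcases trichotomous_of r i k with h | rfl | h
    · exact ⟨i, (hk i h).1 hiT, hiS, fun j hj => (hi j hj).trans (hk j (_root_.trans hj h))⟩
    · exact (hkT hiT).elim
    · exact ⟨k, hkR, fun hkS => hkT ((hi k h).1 hkS),
        fun j hj => (hi j (_root_.trans hj h)).trans (hk j hj)⟩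
  trichotomous := by
    intro S T h1 h2
    by_contra hne
    have hex : {j | ¬ (j ∈ S ↔ j ∈ T)}.Nonempty := by
      by_contra he
      exact hne (Set.ext fun j => by
        by_contra hj
        exact he ⟨j, hj⟩)
    obtain ⟨m, hm, hmin⟩ := (Finite.wellFounded_of_trans_of_irrefl r).has_min _ hex
    have hmin' : ∀ j, r j m → (j ∈ S ↔ j ∈ T) := fun j hj => by
      by_contra h
      exact hmin j h hj
    by_cases hS : m ∈ S
    · exact h2 ⟨m, hS, fun hT => hm ⟨fun _ => hT, fun _ => hS⟩, fun j hj => (hmin' j hj).symm⟩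
    · exact h1 ⟨m, by by_contra hT; exact hm ⟨fun h => (hS h).elim, fun h => (hT h).elim⟩, hS,
        hmin'⟩

end LexLT

theorem exists_equiv_fin {X : Type*} [Finite X] (r : X → X → Prop) [IsStrictTotalOrder X r] :
    ∃ e : Fin (Nat.card X) ≃ X, ∀ i j, i < j ↔ r (e i) (e j) := by
  classical
  let := linearOrderOfSTO r
  cases nonempty_fintype X
  let e := Fintype.orderIsoFinOfCardEq X (Nat.card_eq_fintype_card (α := X)).symm
  exact ⟨e.toEquiv, fun i j => (e.lt_iff_lt (x := i) (y := j)).symm⟩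

/-! ### Embeddings and copies -/

/-- Reflection of the linear orders, and injectivity, come for free. -/
theorem IsEmbedding.of_lt {A B : LinOrdPoset.{u}} {f : A.Carrier → B.Carrier}
    (hle : ∀ a b, a ≤ b ↔ f a ≤ f b) (hlt : ∀ a b, A.lt a b → B.lt (f a) (f b)) :
    IsEmbedding A B f where
  injective a b h := le_antisymm ((hle a b).2 h.le) ((hle b a).2 h.ge)
  le_iff := hle
  lt_iff a b := by
    have := A.strictTotal
    have := B.strictTotal
    refine ⟨hlt a b, fun h => ?_⟩
    rcases trichotomous_of A.lt a b with h' | rfl | h'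
    · exact h'
    · exact (irrefl_of B.lt _ h).elim
    · exact (asymm_of B.lt h (hlt b a h')).elim

theorem IsEmbedding.comp {A B C : LinOrdPoset.{u}} {f : A.Carrier → B.Carrier}
    {g : B.Carrier → C.Carrier} (hg : IsEmbedding B C g) (hf : IsEmbedding A B f) :
    IsEmbedding A C (g ∘ f) where
  injective := hg.injective.comp hf.injective
  le_iff a b := (hf.le_iff a b).trans (hg.le_iff _ _)
  lt_iff a b := (hf.lt_iff a b).trans (hg.lt_iff _ _)

theorem IsEmbedding.range_mem_copies {A B : LinOrdPoset.{u}} {f : A.Carrier → B.Carrier}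
    (hf : IsEmbedding A B f) : Set.range f ∈ copies A B :=
  ⟨Set.rangeFactorization f, ⟨fun _ _ h => hf.injective (congrArg Subtype.val h),
    fun a b => hf.le_iff a b, fun a b => hf.lt_iff a b⟩, Set.rangeFactorization_surjective⟩

theorem exists_isEmbedding_of_mem_copies {A B : LinOrdPoset.{u}} {S : Set B.Carrier}
    (hS : S ∈ copies A B) : ∃ f, IsEmbedding A B f ∧ Set.range f = S := by
  obtain ⟨h, hh, hsurj⟩ := hS
  refine ⟨fun a => (h a).1, ⟨fun a b e => hh.injective (Subtype.ext e), fun a b => hh.le_iff a b,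
    fun a b => hh.lt_iff a b⟩, ?_⟩
  ext x
  refine ⟨?_, fun hx => ?_⟩
  · rintro ⟨a, rfl⟩
    exact (h a).2
  · obtain ⟨a, ha⟩ := hsurj ⟨x, hx⟩
    exact ⟨a, congrArg Subtype.val ha⟩

theorem exists_isEmbedding_of_subset_range {A B C : LinOrdPoset.{u}} {φ : B.Carrier → C.Carrier}
    (hφ : IsEmbedding B C φ) {S : Set C.Carrier} (hS : S ∈ copies A C) (hsub : S ⊆ Set.range φ) :
    ∃ e, IsEmbedding A B e ∧ Set.range (φ ∘ e) = S := by
  obtain ⟨h, hh, rfl⟩ := exists_isEmbedding_of_mem_copies hS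
  choose e he using fun a => hsub (Set.mem_range_self a)
  refine ⟨e, IsEmbedding.of_lt (fun a b => ?_) (fun a b hab => ?_), ?_⟩
  · rw [hφ.le_iff, he, he]; exact hh.le_iff a b
  · rw [hφ.lt_iff, he, he]; exact (hh.lt_iff a b).1 hab
  · congr 1; funext a; exact he a

/-! ### Embeddings into powersets coming from words over upper sets -/

/-- The powerset of an `N`-element chain, ordered by inclusion and by the lexicographic linear
order. -/
def lexPowerset (N : ℕ) : LinOrdPoset.{u} where
  toPartOrd := PartOrd.of (Set (ULift.{u} (Fin N)))
  lt := LexLT (X := ULift.{u} (Fin N)) (· < ·)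
  strictTotal := isStrictTotalOrder_lexLT
  extends_le _ _ h hne := lexLT_of_subset h hne

/-- `U` enumerates the upper sets of the poset `A` as `U 0, …, U (n - 1)`, increasingly for the
lexicographic order induced by the linear order of `A`. Values `U k` with `n ≤ k` are arbitrary. -/
structure IsUpperSetEnum (A : LinOrdPoset.{u}) (n : ℕ) (U : ℕ → Set A.Carrier) : Prop where
  isUpperSet : ∀ k < n, IsUpperSet (U k)
  exists_eq : ∀ V : Set A.Carrier, IsUpperSet V → ∃ k < n, U k = V
  lt_iff : ∀ j < n, ∀ k < n, j < k ↔ LexLT A.lt (U j) (U k)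

theorem exists_isUpperSetEnum (A : LinOrdPoset.{u}) [Finite A.Carrier] :
    ∃ U, IsUpperSetEnum A (Nat.card {V : Set A.Carrier // IsUpperSet V}) U := by
  have := A.strictTotal
  have hlex := isStrictTotalOrder_lexLT (r := A.lt)
  have : IsStrictTotalOrder {V : Set A.Carrier // IsUpperSet V}
      (fun V W => LexLT A.lt V.1 W.1) :=
    { irrefl := fun V => hlex.irrefl V.1
      trans := fun V W Z => hlex.trans V.1 W.1 Z.1
      trichotomous := fun V W h1 h2 => Subtype.ext (hlex.trichotomous V.1 W.1 h1 h2) }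
  obtain ⟨e, he⟩ := exists_equiv_fin
    (fun V W : {V : Set A.Carrier // IsUpperSet V} => LexLT A.lt V.1 W.1)
  refine ⟨fun k => if h : k < _ then (e ⟨k, h⟩).1 else ∅, fun k hk => ?_, fun V hV => ?_,
    fun j hj k hk => ?_⟩
  · simp only [hk, dif_pos]; exact (e _).2
  · refine ⟨e.symm ⟨V, hV⟩, (e.symm _).2, ?_⟩
    simp
  · simp only [hj, hk, dif_pos]; exact he ⟨j, hj⟩ ⟨k, hk⟩

theorem IsUpperSetEnum.injOn {A : LinOrdPoset.{u}} {n : ℕ} {U : ℕ → Set A.Carrier}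
    (hU : IsUpperSetEnum A n U) {j k : ℕ} (hj : j < n) (hk : k < n) (h : U j = U k) : j = k := by
  have hirr : ∀ S : Set A.Carrier, ¬ LexLT A.lt S S := fun _ ⟨_, h1, h2, _⟩ => h2 h1
  rcases lt_trichotomy j k with hlt | rfl | hlt
  · rw [hU.lt_iff j hj k hk, h] at hlt
    exact (hirr _ hlt).elim
  · rfl
  · rw [hU.lt_iff k hk j hj, h] at hlt
    exact (hirr _ hlt).elim

/-- A word `l` of length `N` whose letters number subsets of `X` sends a point to the set of
positions whose letter contains that point. Words are padded with the letter `0`; this matters only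
when `l` is shorter than `N`. -/
def wordMap {X : Type u} (U : ℕ → Set X) (N : ℕ) (l : List ℕ) (a : X) :
    Set (ULift.{u} (Fin N)) := {i | a ∈ U (l.getD i.down 0)}

/-- A word in which every upper set occurs, with first occurrences in lexicographic order, gives an
embedding into the powerset. For `a < b` the first upper set in which `a` and `b` differ contains
`b`, because an upper set with `a` but not `b` comes after the principal upper set `Set.Ici b`. -/
theorem IsUpperSetEnum.isEmbedding_wordMap {A : LinOrdPoset.{u}} [Finite A.Carrier] {n N : ℕ}
    {U : ℕ → Set A.Carrier} (hU : IsUpperSetEnum A n U) {l : List ℕ} (hl : IsWord 0 n l)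
    (hlen : l.length = N) : IsEmbedding A (lexPowerset N) (wordMap U N l) := by
  subst hlen
  have := A.strictTotal
  have hget : ∀ i : Fin l.length, l.getD i 0 = l[i] := fun i => List.getD_eq_getElem _ _ i.2
  have hletter : ∀ i : Fin l.length, l[i] < n := fun i => by
    simpa using hl.lt _ (List.getElem_mem i.2)
  have hprincipal : ∀ b : A.Carrier, ∃ k < n, U k = Set.Ici b := fun b =>
    hU.exists_eq _ (isUpperSet_Ici b)
  refine IsEmbedding.of_lt (fun a b => ⟨fun hab i hi => ?_, fun hab => ?_⟩) (fun a b hab => ?_)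
  · refine hU.isUpperSet _ ?_ hab hi
    rw [hget]; exact hletter _
  · obtain ⟨k, hk, hkU⟩ := hprincipal a
    obtain ⟨i, hi, rfl⟩ := List.getElem_of_mem (hl.mem k (Nat.zero_le _) (by simpa using hk))
    have h1 : a ∈ U (l.getD i 0) := by
      rw [List.getD_eq_getElem _ _ hi, hkU]; exact le_rfl
    have h2 : b ∈ U (l.getD i 0) := hab (a := ULift.up ⟨i, hi⟩) h1
    rwa [List.getD_eq_getElem _ _ hi, hkU] at h2
  · obtain ⟨k, hk, hkU⟩ := hprincipal b
    have hex : {i : Fin l.length | l[i] = k}.Nonempty := by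
      obtain ⟨i, hi, e⟩ := List.getElem_of_mem (hl.mem k (Nat.zero_le _) (by simpa using hk))
      exact ⟨⟨i, hi⟩, e⟩
    obtain ⟨i, hi, hmin⟩ := wellFounded_lt.has_min _ hex
    have hi : l[i] = k := hi
    have hnle : ¬ b ≤ a := fun hba => by
      rcases eq_or_ne b a with rfl | hne
      · exact irrefl_of A.lt _ hab
      · exact asymm_of A.lt hab (A.extends_le b a hba hne)
    refine lexLT_of_forall (i := ULift.up i) ?_ ?_ ?_
    · change b ∈ U (l.getD i 0)
      rw [hget, hi, hkU]; exact le_rfl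
    · change ¬ a ∈ U (l.getD i 0)
      rw [hget, hi, hkU]; exact hnle
    · rintro ⟨j⟩ hj ha
      have hj : j < i := hj
      change a ∈ U (l.getD j 0) at ha
      change b ∈ U (l.getD j 0)
      rw [hget] at ha ⊢
      by_contra hb
      have hlt : k < l[j] := by
        rw [hU.lt_iff k hk _ (hletter j), hkU]
        refine lexLT_of_forall ha hnle fun y hy hby => ?_
        rcases eq_or_ne b y with rfl | hne
        · exact (asymm_of A.lt hab hy).elim
        · exact (asymm_of A.lt hab (_root_.trans (A.extends_le b y hby hne) hy)).elim
      obtain ⟨j', hj', e⟩ := hl.exists_lt_getElem j j.2 k (Nat.zero_le _) hlt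
      exact hmin ⟨j', hj'.trans j.2⟩ e (lt_trans hj' hj)

/-- Taking preimages under an embedding `e : A → B` turns upper sets of `B` into upper sets of `A`.
Read as a word this is again a parameter word: the first upper set of `B` with preimage `W` is the
upper closure of `e '' W`, and `W ↦ upperClosure (e '' W)` is lexicographically increasing. -/
theorem IsEmbedding.exists_isWord_preimage {A B : LinOrdPoset.{u}} [Finite A.Carrier]
    [Finite B.Carrier] {e : A.Carrier → B.Carrier} (he : IsEmbedding A B e) {n n' : ℕ}
    {U : ℕ → Set A.Carrier} {V : ℕ → Set B.Carrier} (hU : IsUpperSetEnum A n U)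
    (hV : IsUpperSetEnum B n' V) :
    ∃ g, IsWord 0 n g ∧ g.length = n' ∧ ∀ k < n', U (g.getD k 0) = e ⁻¹' V k := by
  have := A.strictTotal
  have := B.strictTotal
  have hpre : ∀ k : Fin n', ∃ j < n, U j = e ⁻¹' V k := fun k =>
    hU.exists_eq _ fun a b hab ha => hV.isUpperSet k k.2 ((he.le_iff a b).1 hab) ha
  choose u hun huU using hpre
  have hspan : ∀ c < n, ∃ k, ∃ hk : k < n', V k = upperClosure (e '' U c) ∧ u ⟨k, hk⟩ = c := by
    intro c hc
    obtain ⟨k, hk, hkV⟩ := hV.exists_eq (upperClosure (e '' U c)) (UpperSet.upper _)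
    refine ⟨k, hk, hkV, hU.injOn (hun _) hc ?_⟩
    rw [huU, hkV]
    ext a
    simp only [Set.mem_preimage, SetLike.mem_coe, mem_upperClosure, Set.exists_mem_image]
    refine ⟨?_, fun ha => ⟨a, ha, le_rfl⟩⟩
    rintro ⟨v, hv, hva⟩
    exact hU.isUpperSet c hc ((he.le_iff v a).2 hva) hv
  refine ⟨List.ofFn u, IsWord.of_getElem ?_ ?_ ?_, by simp, fun k hk => ?_⟩
  · intro c hc
    obtain ⟨i, rfl⟩ := (List.mem_ofFn' _ _).1 hc
    simpa using hun i
  · intro c _ hc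
    obtain ⟨k, hk, -, hkc⟩ := hspan c (by simpa using hc)
    exact (List.mem_ofFn' _ _).2 ⟨_, hkc⟩
  · intro i hi c _ hc
    have hi' : i < n' := by simpa using hi
    rw [List.getElem_ofFn] at hc
    have hcn : c < n := hc.trans (hun _)
    obtain ⟨k, hk, hkV, hkc⟩ := hspan c hcn
    refine ⟨k, ?_, by rw [List.getElem_ofFn]; exact hkc⟩
    rw [hV.lt_iff k hk i hi', hkV]
    rw [hU.lt_iff c hcn _ (hun _), huU] at hc
    obtain ⟨x, hxi, hxc, hx⟩ := hc
    refine lexLT_of_forall (i := e x) hxi ?_ ?_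
    · simp only [SetLike.mem_coe, mem_upperClosure, Set.exists_mem_image]
      rintro ⟨v, hv, hvx⟩
      exact hxc (hU.isUpperSet c hcn ((he.le_iff v x).2 hvx) hv)
    · simp only [SetLike.mem_coe, mem_upperClosure, Set.exists_mem_image]
      rintro y hy ⟨v, hv, hvy⟩
      have hvx : A.lt v x := by
        rw [he.lt_iff]
        rcases eq_or_ne (e v) y with rfl | hne
        · exact hy
        · exact _root_.trans (B.extends_le _ _ hvy hne) hy
      exact hV.isUpperSet i hi' hvy ((hx v hvx).1 hv)
  · rw [List.getD_eq_getElem _ _ (by simpa using hk), List.getElem_ofFn]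
    exact huU ⟨k, hk⟩

/-- Composing the embedding given by a word `f` over the upper sets of `B` with an embedding
`e : A → B` amounts to substituting into `f` the word of preimages under `e`. So the monochromatic
`f` of the Graham–Rothschild theorem gives a monochromatic copy of `B`. -/
theorem exists_arrows_lexPowerset (A B : LinOrdPoset.{u}) [Finite A.Carrier] [Finite B.Carrier]
    {k : ℕ} (hk : 0 < k) : ∃ N, Arrows (lexPowerset.{u} N) B A k := by
  obtain ⟨U, hU⟩ := exists_isUpperSetEnum A
  obtain ⟨V, hV⟩ := exists_isUpperSetEnum B
  obtain ⟨N, hN⟩ := grahamRothschild 0 (Nat.card {W : Set A.Carrier // IsUpperSet W})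
    (Nat.card {W : Set B.Carrier // IsUpperSet W}) (Fin k)
  refine ⟨N, fun χ => ?_⟩
  classical
  obtain ⟨f, hf, hfl, j, hj⟩ := hN fun l =>
    if h : Set.range (wordMap U N l) ∈ copies A (lexPowerset N) then χ ⟨_, h⟩ else ⟨0, hk⟩
  have hφ := hV.isEmbedding_wordMap hf hfl
  refine ⟨_, hφ.range_mem_copies, j, fun S hS => ?_⟩
  obtain ⟨e, he, heS⟩ := exists_isEmbedding_of_subset_range hφ S.2 hS
  obtain ⟨g, hg, hgl, hgU⟩ := he.exists_isWord_preimage hU hV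
  have hcomp : wordMap V N f ∘ e = wordMap U N (f.map (sub 0 g)) := by
    funext a
    ext ⟨i⟩
    have hi : (i : ℕ) < f.length := by rw [hfl]; exact i.2
    have hlt : f[(i : ℕ)] < _ := hf.lt _ (List.getElem_mem hi)
    rw [Nat.zero_add] at hlt
    change e a ∈ V (f.getD i 0) ↔ a ∈ U ((f.map (sub 0 g)).getD i 0)
    rw [List.getD_eq_getElem _ _ hi, List.getD_eq_getElem _ _ (by simpa using hi),
      List.getElem_map]
    have hs : sub 0 g f[(i : ℕ)] = g.getD f[(i : ℕ)] 0 := by simp [sub]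
    rw [hs, hgU _ hlt]
    rfl
  replace heS := (congrArg Set.range hcomp).symm.trans heS
  have hc := hj g hg hgl
  have hmem : Set.range (wordMap U N (f.map (sub 0 g))) ∈ copies A (lexPowerset N) := by
    rw [heS]; exact S.2
  rw [dif_pos hmem] at hc
  rw [← hc]
  congr 1
  exact Subtype.ext heS.symm

/-! ### The ordering property -/

theorem isEmbedding_lexPowerset_of_le {M N : ℕ} (h : M ≤ N) :
    IsEmbedding (lexPowerset.{u} M) (lexPowerset N)
      (fun S : Set (ULift.{u} (Fin M)) => {i : ULift.{u} (Fin N) |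
        ∃ hi : (i.down : ℕ) < M, ULift.up ⟨i.down, hi⟩ ∈ S}) := by
  refine IsEmbedding.of_lt (fun S T => ⟨fun hST i ⟨hi, hiS⟩ => ⟨hi, hST hiS⟩, fun hST i hi => ?_⟩) ?_
  · exact (hST (a := ULift.up (Fin.castLE h i.down)) ⟨i.down.2, hi⟩).2
  · rintro S T ⟨i, hiT, hiS, hi⟩
    refine lexLT_of_forall (i := ULift.up (Fin.castLE h i.down)) ⟨i.down.2, hiT⟩
      (fun ⟨_, h'⟩ => hiS h') ?_
    rintro j hj ⟨hjM, hjS⟩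
    exact ⟨hjM, (hi _ hj).1 hjS⟩

theorem embeds_lexPowerset (A : LinOrdPoset.{u}) [Finite A.Carrier] {N : ℕ}
    (hN : Nat.card {V : Set A.Carrier // IsUpperSet V} ≤ N) : Embeds A (lexPowerset.{u} N) := by
  obtain ⟨U, hU⟩ := exists_isUpperSetEnum A
  exact ⟨_, (isEmbedding_lexPowerset_of_le hN).comp
    (hU.isEmbedding_wordMap (IsWord.identity 0 _) (by simp))⟩

/-- The two-element antichain with a linear order. -/
def orderedAntichain : LinOrdPoset.{u} where
  toPartOrd := @PartOrd.of (ULift.{u} Bool)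
    { le := Eq
      lt := fun _ _ => False
      lt_iff_le_not_ge := fun _ _ => ⟨False.elim, fun h => h.2 h.1.symm⟩
      le_refl := fun _ => rfl
      le_trans := fun _ _ _ => Eq.trans
      le_antisymm := fun _ _ h _ => h }
  lt a b := a.down < b.down
  strictTotal :=
    { trichotomous := fun _ _ h1 h2 =>
        ULift.ext _ _ (le_antisymm (not_lt.1 h2) (not_lt.1 h1))
      irrefl := fun a => lt_irrefl a.down
      trans := fun a b c => lt_trans (a := a.down) (b := b.down) (c := c.down) }
  extends_le _ _ h hne := (hne h).elim

instance : Finite (orderedAntichain.{u}).Carrier := inferInstanceAs (Finite (ULift.{u} Bool))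

instance (N : ℕ) : Finite (lexPowerset.{u} N).Carrier :=
  inferInstanceAs (Finite (Set (ULift.{u} (Fin N))))

theorem pair_mem_copies_orderedAntichain {C : LinOrdPoset.{u}} {x y : C.Carrier} (hlt : C.lt x y)
    (hxy : ¬ x ≤ y) : {x, y} ∈ copies orderedAntichain C := by
  have := C.strictTotal
  have hyx : ¬ y ≤ x := fun h =>
    asymm_of C.lt hlt (C.extends_le y x h fun e => hxy e.ge)
  have hemb : IsEmbedding orderedAntichain C
      (fun b : ULift.{u} Bool => bif b.down then y else x) := by
    refine IsEmbedding.of_lt ?_ ?_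
    · rintro ⟨_ | _⟩ ⟨_ | _⟩
      · exact ⟨fun _ => le_rfl, fun _ => rfl⟩
      · exact ⟨fun h => (by cases h), fun h => (hxy h).elim⟩
      · exact ⟨fun h => (by cases h), fun h => (hyx h).elim⟩
      · exact ⟨fun _ => le_rfl, fun _ => rfl⟩
    · rintro ⟨_ | _⟩ ⟨_ | _⟩ h
      · exact (lt_irrefl _ h).elim
      · exact hlt
      · exact absurd (show true < false from h) (by decide)
      · exact (lt_irrefl _ h).elim
  convert hemb.range_mem_copies
  ext z
  constructor
  · rintro (rfl | rfl)
    · exact ⟨⟨false⟩, rfl⟩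
    · exact ⟨⟨true⟩, rfl⟩
  · rintro ⟨⟨_ | _⟩, rfl⟩
    · exact Or.inl rfl
    · exact Or.inr rfl

/-- Reversing a linear extension on all incomparable pairs does not give a linear extension when
there are `a < b < c` with `a ⊏ c` and `b` incomparable to both. -/
theorem exists_reversal_obstruction {N : ℕ} (hN : 3 ≤ N) :
    ∃ a b c : (lexPowerset.{u} N).Carrier, (lexPowerset N).lt a b ∧ (lexPowerset N).lt b c ∧
      ¬ a ≤ b ∧ ¬ b ≤ c ∧ a ≤ c ∧ a ≠ c := by
  -- The configuration is `{2} < {1} < {0, 2}`.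
  let i (k : ℕ) (hk : k < 3) : ULift.{u} (Fin N) := ⟨⟨k, by omega⟩⟩
  have hi : ∀ {j k : ℕ} (hj : j < 3) (hk : k < 3), i j hj = i k hk → j = k := by
    intro j k hj hk e
    simpa [i] using e
  let a : Set (ULift.{u} (Fin N)) := {i 2 (by omega)}
  let b : Set (ULift.{u} (Fin N)) := {i 1 (by omega)}
  let c : Set (ULift.{u} (Fin N)) := {i 0 (by omega), i 2 (by omega)}
  refine ⟨a, b, c, ?_, ?_, ?_, ?_, ?_, ?_⟩
  · refine lexLT_of_forall (i := i 1 (by omega)) rfl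
      (fun h => absurd (hi (by omega) (by omega) h) (by omega)) ?_
    rintro j hj rfl
    exact absurd (show (2 : ℕ) < 1 from hj) (by omega)
  · refine lexLT_of_forall (i := i 0 (by omega)) (Or.inl rfl)
      (fun h => absurd (hi (by omega) (by omega) h) (by omega)) ?_
    rintro j hj rfl
    exact absurd (show (1 : ℕ) < 0 from hj) (by omega)
  · intro h
    exact absurd (hi (by omega) (by omega) (h (a := i 2 (by omega)) rfl)) (by omega)
  · intro h
    rcases h (a := i 1 (by omega)) rfl with h | h <;>
      exact absurd (hi (by omega) (by omega) h) (by omega)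
  · rintro j rfl
    exact Or.inr rfl
  · intro h
    have h' : i 0 (by omega) ∈ a := by
      change a = c at h
      rw [h]; exact Or.inl rfl
    exact absurd (hi (by omega) (by omega) h') (by omega)

theorem ramseyProperty_of_lexPowerset_mem {K : Set LinOrdPoset.{u}}
    (hfin : ∀ A ∈ K, Finite A.Carrier) (hK : ∀ N, lexPowerset N ∈ K) : RamseyProperty K := by
  intro A hA B hB _ k hk
  have := hfin A hA
  have := hfin B hB
  obtain ⟨N, hN⟩ := exists_arrows_lexPowerset A B (k := k) (by omega)
  exact ⟨_, hK N, hN⟩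

/-- The powerset `lexPowerset M` embeds, with its lexicographic order, into every linear extension
of one sufficiently large powerset. -/
theorem exists_forall_embeds_of_toPartOrd_eq {M : ℕ} (hM : 3 ≤ M) :
    ∃ N, ∀ B : LinOrdPoset.{u}, B.toPartOrd = (lexPowerset.{u} N).toPartOrd →
      Embeds (lexPowerset M) B := by
  obtain ⟨N, hN⟩ := exists_arrows_lexPowerset orderedAntichain.{u} (lexPowerset.{u} M)
    (k := 2) two_pos
  refine ⟨N, fun B hB => ?_⟩
  obtain ⟨P, lt, st, ext⟩ := B
  have hB : P = (lexPowerset.{u} N).toPartOrd := hB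
  subst hB
  classical
  obtain ⟨T, hT, j, hj⟩ := hN fun S =>
    if ∃ x ∈ S.1, ∃ y ∈ S.1, (lexPowerset N).lt x y ∧ lt x y then 0 else 1
  obtain ⟨ψ, hψ, rfl⟩ := exists_isEmbedding_of_mem_copies hT
  have hasym := (lexPowerset.{u} N).strictTotal
  -- The colour of an incomparable pair records whether the two linear orders agree on it.
  have hcol : ∀ x y, (lexPowerset.{u} M).lt x y → ¬ x ≤ y → (lt (ψ x) (ψ y) ↔ j = 0) := by
    intro x y hxy hle
    have hlt := (hψ.lt_iff x y).1 hxy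
    have hc := hj ⟨_, pair_mem_copies_orderedAntichain hlt fun h => hle ((hψ.le_iff x y).2 h)⟩
      (by rintro z (rfl | rfl) <;> exact Set.mem_range_self _)
    rw [← hc]
    constructor
    · intro h
      exact if_pos ⟨_, Or.inl rfl, _, Or.inr rfl, hlt, h⟩
    · intro h
      by_contra hno
      rw [if_neg] at h
      · exact absurd h (by decide)
      · rintro ⟨p, rfl | rfl, q, rfl | rfl, h1, h2⟩
        · exact irrefl_of (lexPowerset.{u} N).lt _ h1
        · exact hno h2
        · exact asymm_of (lexPowerset.{u} N).lt h1 hlt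
        · exact irrefl_of (lexPowerset.{u} N).lt _ h1
  -- If they disagreed on every incomparable pair, the configuration above would give a cycle.
  have hj0 : j = 0 := by
    obtain ⟨a, b, c, hab, hbc, nab, nbc, hac, hne⟩ := exists_reversal_obstruction.{u} hM
    by_contra hj0
    have h1 : lt (ψ b) (ψ a) := by
      rcases trichotomous_of lt (ψ a) (ψ b) with h | h | h
      · exact (hj0 ((hcol a b hab nab).1 h)).elim
      · exact (nab (hψ.injective h).le).elim
      · exact h
    have h2 : lt (ψ c) (ψ b) := by
      rcases trichotomous_of lt (ψ b) (ψ c) with h | h | h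
      · exact (hj0 ((hcol b c hbc nbc).1 h)).elim
      · exact (nbc (hψ.injective h).le).elim
      · exact h
    exact asymm_of lt (_root_.trans h2 h1)
      (ext _ _ ((hψ.le_iff a c).1 hac) fun e => hne (hψ.injective e))
  refine ⟨ψ, IsEmbedding.of_lt hψ.le_iff fun x y hxy => ?_⟩
  by_cases hle : x ≤ y
  · refine ext _ _ ((hψ.le_iff x y).1 hle) fun e => ?_
    have := (lexPowerset.{u} M).strictTotal
    exact irrefl_of (lexPowerset.{u} M).lt x (by simpa [hψ.injective e] using hxy)
  · exact (hcol x y hxy hle).2 hj0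

theorem orderingProperty_of_lexPowerset_mem {K : Set LinOrdPoset.{u}}
    (hfin : ∀ A ∈ K, Finite A.Carrier) (hK : ∀ N, lexPowerset N ∈ K) : OrderingProperty K := by
  rintro P -
  -- The size of the powerset into which `P` embeds does not depend on the linear extension of `P`.
  obtain ⟨N, hN⟩ := exists_forall_embeds_of_toPartOrd_eq.{u}
    (M := max 3 (Nat.card {V : Set P // IsUpperSet V})) (le_max_left _ _)
  refine ⟨_, ⟨_, hK N, rfl⟩, ?_⟩
  rintro A hA rfl B - hB
  have := hfin A hA
  obtain ⟨f, hf⟩ := embeds_lexPowerset A (le_max_right 3 _)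
  obtain ⟨g, hg⟩ := hN B hB
  exact ⟨_, hg.comp hf⟩

end LinOrdPoset

/-! ### Powersets in varieties -/

theorem exists_lt_of_nontrivial (L : Type*) [SemilatticeInf L] [Nontrivial L] :
    ∃ a b : L, a < b := by
  obtain ⟨x, y, hne⟩ := exists_pair_ne L
  by_cases h : x ≤ y
  · exact ⟨x, y, lt_of_le_of_ne h hne⟩
  · exact ⟨x ⊓ y, x, inf_lt_left.2 h⟩

namespace LatticeVariety

open Classical in
/-- The powerset of `ι` is the power `2 ^ ι` of a two-element sublattice of a member. -/
theorem IsNontrivial.mem_set {V : LatticeVariety.{u}} (hV : V.IsNontrivial) (ι : Type u) :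
    V.Mem (Set ι) := by
  obtain ⟨L, _, hL, _⟩ := hV
  obtain ⟨a, b, hab⟩ := exists_lt_of_nontrivial L
  refine V.sub (ι → L) (Set ι)
    { toFun := fun S i => if i ∈ S then b else a
      map_sup' := fun S T => ?_
      map_inf' := fun S T => ?_ } (fun S T h => Set.ext fun i => ?_) (V.prod ι _ fun _ => hL)
  · funext i
    by_cases hS : i ∈ S <;> by_cases hT : i ∈ T <;> simp [hS, hT, hab.le]
  · funext i
    by_cases hS : i ∈ S <;> by_cases hT : i ∈ T <;> simp [hS, hT, hab.le]
  · have := congrFun h i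
    by_cases hS : i ∈ S <;> by_cases hT : i ∈ T <;> simp_all [hab.ne, hab.ne']

theorem finite_of_mem_ordRelFin {V : LatticeVariety.{u}} {A : LinOrdPoset.{u}}
    (hA : A ∈ V.ordRelFin) : Finite A.Carrier := by
  obtain ⟨L, _, hfin, -, h⟩ := hA
  change Finite A.toPartOrd
  rw [h]; exact hfin

theorem IsNontrivial.lexPowerset_mem {V : LatticeVariety.{u}} (hV : V.IsNontrivial) (N : ℕ) :
    LinOrdPoset.lexPowerset N ∈ V.ordRelFin :=
  ⟨Set (ULift.{u} (Fin N)), inferInstance, inferInstance, hV.mem_set _, rfl⟩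

end LatticeVariety

namespace SemilatticeVariety

open Classical in
/-- The powerset of `ι` is the power `2 ^ ι` of a two-element subsemilattice of a member. -/
theorem IsNontrivial.mem_set {V : SemilatticeVariety.{u}} (hV : V.IsNontrivial) (ι : Type u) :
    V.Mem (Set ι) := by
  obtain ⟨L, _, hL, _⟩ := hV
  obtain ⟨a, b, hab⟩ := exists_lt_of_nontrivial L
  refine V.sub (ι → L) (Set ι)
    { toFun := fun S i => if i ∈ S then b else a
      map_inf' := fun S T => ?_ } (fun S T h => Set.ext fun i => ?_) (V.prod ι _ fun _ => hL)
  · funext i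
    by_cases hS : i ∈ S <;> by_cases hT : i ∈ T <;> simp [hS, hT, hab.le]
  · have := congrFun h i
    by_cases hS : i ∈ S <;> by_cases hT : i ∈ T <;> simp_all [hab.ne, hab.ne']

theorem finite_of_mem_ordRelFin {V : SemilatticeVariety.{u}} {A : LinOrdPoset.{u}}
    (hA : A ∈ V.ordRelFin) : Finite A.Carrier := by
  obtain ⟨L, _, hfin, -, h⟩ := hA
  change Finite A.toPartOrd
  rw [h]; exact hfin

theorem IsNontrivial.lexPowerset_mem {V : SemilatticeVariety.{u}} (hV : V.IsNontrivial) (N : ℕ) :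
    LinOrdPoset.lexPowerset N ∈ V.ordRelFin :=
  ⟨Set (ULift.{u} (Fin N)), inferInstance, inferInstance, hV.mem_set _, rfl⟩

end SemilatticeVariety

theorem theorem3p4 :
    (∀ V : LatticeVariety.{u}, V.IsNontrivial →
      LinOrdPoset.RamseyProperty V.ordRelFin ∧ LinOrdPoset.OrderingProperty V.ordRelFin) ∧
    (∀ V : SemilatticeVariety.{u}, V.IsNontrivial →
      LinOrdPoset.RamseyProperty V.ordRelFin ∧ LinOrdPoset.OrderingProperty V.ordRelFin) :=
  ⟨fun _ hV =>
    ⟨LinOrdPoset.ramseyProperty_of_lexPowerset_mem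
        (fun _ => LatticeVariety.finite_of_mem_ordRelFin) hV.lexPowerset_mem,
      LinOrdPoset.orderingProperty_of_lexPowerset_mem
        (fun _ => LatticeVariety.finite_of_mem_ordRelFin) hV.lexPowerset_mem⟩,
    fun _ hV =>
    ⟨LinOrdPoset.ramseyProperty_of_lexPowerset_mem
        (fun _ => SemilatticeVariety.finite_of_mem_ordRelFin) hV.lexPowerset_mem,
      LinOrdPoset.orderingProperty_of_lexPowerset_mem
        (fun _ => SemilatticeVariety.finite_of_mem_ordRelFin) hV.lexPowerset_mem⟩⟩
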